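/- Let $\varphi:[0,\infty)\to\mathbb R$ be a positive definite radial function, i.e. $\varphi$ is smooth on $(0,\infty)$ with $(-1)^k\varphi^{(k)}\ge 0$ for all $k\ge 0$, and $\lim_{r\downarrow 0}\varphi(r)=1=\varphi(0)$. Consider a super-Gaussian likelihood for an observation $y_i$ given a latent vector $f_i\in\mathbb R^d$ ($d=1$ for a scalar latent function value), $$p(y_i\mid f_i)=C\,e^{g(y_i)^\top f_i}\,\varphi\big(\|h(f_i,y_i)\|_2^2\big),$$ where $C>0$, $g$ is arbitrary, and $h$ is $\mathbb R^m$-valued and affine in $f_i$, so that $\|h(f_i,y_i)\|_2^2$ is a quadratic polynomial in $f_i$ (for instance $\alpha(y_i)-\beta(y_i)^\top f_i+\gamma(y_i)\|f_i\|_2^2$). Let $f=(f_1,\dots,f_n)$ consist of values of a Gaussian process at given inputs, with law $p(f)$ (possibly degenerate), and let $p(y\mid f)=\prod_i p(y_i\mid f_i)$. The single-block likelihood $C e^{g(y)^\top f}\varphi(\|h(f,y)\|_2^2)$ is the case $n=1$. Then: (1) There is exactly one Borel measure $\pi_\varphi(\cdot\mid 0)$ on $[0,\infty)$, the inverse Laplace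 transform of $\varphi$, with $\int e^{-r\omega}\,\pi_\varphi(d\omega\mid 0)=\varphi(r)$ for all $r>0$. It is a probability measure (not necessarily with a density), and so is each exponential tilting $\pi_\varphi(d\omega\mid c)=e^{-c^2\omega}\,\pi_\varphi(d\omega\mid 0)/\varphi(c^2)$, $c\in\mathbb R$. (2) Put $p(y_i\mid f_i,\omega_i)=C\exp\big(g(y_i)^\top f_i-\|h(f_i,y_i)\|_2^2\,\omega_i\big)$, $p(y\mid f,\omega)=\prod_i p(y_i\mid f_i,\omega_i)$ and $p(d\omega)=\prod_i\pi_\varphi(d\omega_i\mid 0)$. Then $p(y_i\mid f_i)=\int p(y_i\mid f_i,\omega_i)\,\pi_\varphi(d\omega_i\mid 0)$ and $p(y\mid f)=\int p(y\mid f,\omega)\,p(d\omega)$, and integrating $\omega$ out of the augmented model $p(y\mid f,\omega)\,p(df)\,p(d\omega)$ gives the original model $p(y\mid f)\,p(df)$. (3) For given $y$ the augmented model has a well-defined posterior $p(f,\omega\mid y)$ (its total mass in $(f,\omega)$ is finite and positive), and it is conditionally conjugate: the prior $p(f)$ and the complete conditional $p(f\mid\omega,y)$ are Gaussian, and the complete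 conditional $p(\omega\mid f,y)$ is the product $\prod_i\pi_\varphi(\cdot\mid c_i)$ with $c_i=\|h(f_i,y_i)\|_2$, i.e. each $\omega_i$ has an exponential tilting of its prior $\pi_\varphi(\cdot\mid 0)$. -/

import Mathlib

open MeasureTheory ProbabilityTheory Filter Topology
open scoped NNReal ENNReal ContDiff

noncomputable section

/-- `φ` is a positive definite radial function: it is completely monotone
(smooth on `(0, ∞)` with `(-1)^k φ^(k) ≥ 0` for all `k`, and defined at `0` by continuity)
and `φ(r) → 1` as `r ↓ 0`. Only the values of `φ` on `[0, ∞)` matter. -/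
structure IsPDR (φ : ℝ → ℝ) : Prop where
  contDiffOn : ContDiffOn ℝ ∞ φ (Set.Ioi 0)
  alternating : ∀ (k : ℕ) (r : ℝ), 0 < r → 0 ≤ (-1) ^ k * iteratedDeriv k φ r
  tendsto_zero : Tendsto φ (𝓝[>] 0) (𝓝 1)
  map_zero : φ 0 = 1

/-- The Borel measure `μ` on `[0, ∞)` has Laplace transform `φ`:
`∫ exp (-r ω) dμ(ω)` converges and equals `φ(r)`, for every `r > 0`. -/
def HasLaplaceTransform (μ : Measure ℝ≥0) (φ : ℝ → ℝ) : Prop :=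
  ∀ r : ℝ, 0 < r →
    Integrable (fun w : ℝ≥0 => Real.exp (-(r * w))) μ ∧
      ∫ w : ℝ≥0, Real.exp (-(r * w)) ∂μ = φ r

open Classical in
/-- The inverse Laplace transform of `φ`, as a measure on `[0, ∞)`: the measure whose Laplace
transform is `φ` (and `0` if there is none). -/
def inverseLaplace (φ : ℝ → ℝ) : Measure ℝ≥0 :=
  if h : ∃ μ : Measure ℝ≥0, HasLaplaceTransform μ φ then h.choose else 0

/-- The family `π_φ(ω | c) = exp (-c² ω) π_φ(ω | 0) / φ(c²)`: exponential tiltings of the inverse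
Laplace transform of `φ`. -/
def piPhi (φ : ℝ → ℝ) (c : ℝ) : Measure ℝ≥0 :=
  (inverseLaplace φ).withDensity
    (fun w => ENNReal.ofReal (Real.exp (-(c ^ 2 * (w : ℝ))) / φ (c ^ 2)))

/-- A super-Gaussian likelihood (at a fixed value of its hyperparameters) for an observation in `𝒴`
given a latent vector in `ℝ^κ`: `p(y | f) = C exp (g(y)ᵀ f) φ(‖h(f, y)‖²)`, with `h` linear
(affine) in `f`, so that `‖h(f, y)‖²` is a quadratic polynomial in `f`. This includes the isotropic
case `‖h(f, y)‖² = α(y) - β(y)ᵀ f + γ(y) ‖f‖²`, and every case with `κ` a single index. -/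
structure SuperGaussianLikelihood (𝒴 κ : Type*) [Fintype κ] where
  /-- normalizing constant -/
  C : ℝ
  C_pos : 0 < C
  g : 𝒴 → EuclideanSpace ℝ κ
  φ : ℝ → ℝ
  isPDR : IsPDR φ
  /-- dimension of the target of `h` -/
  m : ℕ
  h : 𝒴 → (EuclideanSpace ℝ κ →ᵃ[ℝ] EuclideanSpace ℝ (Fin m))

namespace SuperGaussianLikelihood

variable {𝒴 κ : Type*} [Fintype κ] (L : SuperGaussianLikelihood 𝒴 κ)

/-- `p(y | f) = C exp (g(y)ᵀ f) φ(‖h(f, y)‖²)` -/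
def lik (y : 𝒴) (f : EuclideanSpace ℝ κ) : ℝ :=
  L.C * Real.exp (inner ℝ (L.g y) f) * L.φ (‖L.h y f‖ ^ 2)

/-- `p(y | f, ω) = C exp (g(y)ᵀ f - ‖h(f, y)‖² ω)` -/
def augLik (y : 𝒴) (f : EuclideanSpace ℝ κ) (w : ℝ≥0) : ℝ :=
  L.C * Real.exp (inner ℝ (L.g y) f - ‖L.h y f‖ ^ 2 * w)

end SuperGaussianLikelihood

section Model

variable {𝒴 ι κ : Type*} [Fintype ι] [Fintype κ]

/-- The block `fᵢ ∈ ℝ^κ` of the vector of all latent values. -/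
def block (f : EuclideanSpace ℝ (ι × κ)) (i : ι) : EuclideanSpace ℝ κ :=
  WithLp.toLp 2 (fun k => f (i, k))

/-- The likelihood `p(y | f) = ∏ᵢ p(yᵢ | fᵢ)` of all observations. -/
def fullLik (L : SuperGaussianLikelihood 𝒴 κ) (y : ι → 𝒴) (f : EuclideanSpace ℝ (ι × κ)) : ℝ :=
  ∏ i, L.lik (y i) (block f i)

/-- The augmented likelihood `p(y | f, ω) = ∏ᵢ p(yᵢ | fᵢ, ωᵢ)`. -/
def fullAugLik (L : SuperGaussianLikelihood 𝒴 κ) (y : ι → 𝒴) (f : EuclideanSpace ℝ (ι × κ))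
    (w : ι → ℝ≥0) : ℝ :=
  ∏ i, L.augLik (y i) (block f i) (w i)

/-- The prior `p(f)`: the joint law of the values `f_j = F (x j)` of the process `F` at the
inputs `x j`. -/
def gpPrior {T Ω : Type*} [MeasurableSpace Ω] (F : T → Ω → ℝ) (P : Measure Ω) (x : ι × κ → T) :
    Measure (EuclideanSpace ℝ (ι × κ)) :=
  P.map (fun a => WithLp.toLp 2 (fun j => F (x j) a))

/-- The prior `p(ω) = ∏ᵢ π_φ(ωᵢ | 0)` of the auxiliary variables. -/
def auxPrior (ι : Type*) [Fintype ι] (φ : ℝ → ℝ) : Measure (ι → ℝ≥0) :=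
  Measure.pi (fun _ => piPhi φ 0)

/-- The original model `p(y, f) = p(y | f) p(f)`, for given data `y`, as a measure in `f`. -/
def modelJoint (L : SuperGaussianLikelihood 𝒴 κ) (prior : Measure (EuclideanSpace ℝ (ι × κ)))
    (y : ι → 𝒴) : Measure (EuclideanSpace ℝ (ι × κ)) :=
  prior.withDensity (fun f => ENNReal.ofReal (fullLik L y f))

/-- The augmented model `p(y, f, ω) = p(y | f, ω) p(f) p(ω)`, for given data `y`, as a measure
in `(f, ω)`. -/
def augJoint (L : SuperGaussianLikelihood 𝒴 κ) (prior : Measure (EuclideanSpace ℝ (ι × κ)))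
    (y : ι → 𝒴) : Measure (EuclideanSpace ℝ (ι × κ) × (ι → ℝ≥0)) :=
  (prior.prod (auxPrior ι L.φ)).withDensity
    (fun p => ENNReal.ofReal (fullAugLik L y p.1 p.2))

/-- The posterior `p(f, ω | y) = p(y, f, ω) / p(y)` of the augmented model. -/
def augPosterior (L : SuperGaussianLikelihood 𝒴 κ) (prior : Measure (EuclideanSpace ℝ (ι × κ)))
    (y : ι → 𝒴) : Measure (EuclideanSpace ℝ (ι × κ) × (ι → ℝ≥0)) :=
  (augJoint L prior y Set.univ)⁻¹ • augJoint L prior y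

end Model

end

/-! ### Taylor expansion of completely monotone functions -/

namespace IsPDR

variable {φ : ℝ → ℝ}

/-! The analytic core is Bernstein's theorem. At a point `s`, all the signed Taylor coefficients of
a completely monotone `φ` are nonnegative, and the Taylor series converges to `φ (s - y)` for `0 ≤ y
< s` (`hasSum_taylor`). Substituting `y = s * exp (-r / s)` turns the series into the `r`-th moment
of a discrete probability measure on `[0, 1]` (`exists_discretization`). These moments tend to `φ r`
as `s → ∞`, and compactness of the space of probability measures on `[0, 1]` yields a limit measure.
The substitution `ω = -log t` makes it a measure with Laplace transform `φ`. Uniqueness is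
Stone–Weierstrass for polynomials in `exp (-ω)`.

The mixture identities then follow by setting `r = ‖h‖²` in the Laplace transform and taking
products over `i`.

For fixed `ω`, the log augmented likelihood is a constant plus a linear form minus a nonnegative
combination of squares of affine forms in `f`. Tilting a possibly degenerate Gaussian by a function
of one linear form reduces to dimension one, because every other linear form splits into a multiple
of the given one and an independent residual (`isGaussian_tilted_comp_dual`). Summing such
potentials corresponds to iterating tiltings.

Both complete conditionals come from one disintegration lemma
(`exists_isCondKernel_prod_withDensity`), applied to the joint density and to its swap. -/

lemma contDiffAt (hφ : IsPDR φ) {r : ℝ} (hr : 0 < r) (n : ℕ∞) : ContDiffAt ℝ n φ r :=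
  (hφ.contDiffOn.contDiffAt (Ioi_mem_nhds hr)).of_le (by exact_mod_cast le_top)

lemma hasDerivAt_iteratedDeriv (hφ : IsPDR φ) (k : ℕ) {r : ℝ} (hr : 0 < r) :
    HasDerivAt (iteratedDeriv k φ) (iteratedDeriv (k + 1) φ r) r := by
  rw [iteratedDeriv_succ]
  refine DifferentiableAt.hasDerivAt ?_
  rw [iteratedDeriv_eq_equiv_comp, LinearIsometryEquiv.comp_differentiableAt_iff]
  exact (hφ.contDiffAt hr (k + 1 : ℕ)).differentiableAt_iteratedFDeriv
    (by exact_mod_cast Nat.lt_succ_self k)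

lemma antitoneOn_iteratedDeriv (hφ : IsPDR φ) (k : ℕ) :
    AntitoneOn (fun r => (-1) ^ k * iteratedDeriv k φ r) (Set.Ioi 0) := by
  have hd : ∀ r ∈ Set.Ioi (0 : ℝ), HasDerivAt (fun r => (-1) ^ k * iteratedDeriv k φ r)
      ((-1) ^ k * iteratedDeriv (k + 1) φ r) r := fun r hr =>
    (hφ.hasDerivAt_iteratedDeriv k hr).const_mul _
  refine antitoneOn_of_deriv_nonpos (convex_Ioi 0)
    (fun r hr => (hd r hr).continuousAt.continuousWithinAt)
    (fun r hr => (hd r (interior_subset hr)).differentiableAt.differentiableWithinAt)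
    fun r hr => ?_
  rw [interior_Ioi] at hr
  rw [(hd r hr).deriv]
  have := hφ.alternating (k + 1) r hr
  rw [pow_succ] at this
  linarith

lemma antitoneOn (hφ : IsPDR φ) : AntitoneOn φ (Set.Ioi 0) := by
  simpa using hφ.antitoneOn_iteratedDeriv 0

lemma le_one (hφ : IsPDR φ) {r : ℝ} (hr : 0 < r) : φ r ≤ 1 := by
  refine ge_of_tendsto hφ.tendsto_zero ?_
  filter_upwards [Ioo_mem_nhdsGT hr] with x hx
  exact hφ.antitoneOn hx.1 hr hx.2.le

/-- The remainder term of the Taylor expansion of `φ` at `s`, evaluated at `s - y`. -/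
noncomputable def taylorRemainder (φ : ℝ → ℝ) (s : ℝ) (n : ℕ) (y : ℝ) : ℝ :=
  y ^ (n + 1) * ((n.factorial : ℝ)⁻¹ *
    ∫ t in (0 : ℝ)..1, (1 - t) ^ n * ((-1) ^ (n + 1) * iteratedDeriv (n + 1) φ (s - t * y)))

/-- Taylor's formula with integral remainder for the increment `-y`. The signs of `(-y) ^ k` are
moved onto the derivatives, so that every term is nonnegative. -/
lemma eq_sum_add_taylorRemainder (hφ : IsPDR φ) {s y : ℝ} (hy : 0 ≤ y) (hys : y < s) (n : ℕ) :
    φ (s - y) = ∑ k ∈ Finset.range (n + 1),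
      (k.factorial : ℝ)⁻¹ * ((-1) ^ k * iteratedDeriv k φ s) * y ^ k
        + taylorRemainder φ s n y := by
  have hc : ∀ t ∈ Set.Icc (0 : ℝ) 1, ContDiffAt ℝ (n + 1) φ (s + t • -y) := by
    intro t ht
    refine hφ.contDiffAt ?_ (n + 1 : ℕ)
    have : t * y ≤ 1 * y := mul_le_mul_of_nonneg_right ht.2 hy
    simp only [smul_eq_mul]
    linarith
  have h := map_add_eq_sum_add_integral_iteratedFDeriv hc
  rw [← sub_eq_add_neg] at h
  rw [h, taylorRemainder]
  simp only [iteratedFDeriv_apply_eq_iteratedDeriv_mul_prod, Finset.prod_const, Finset.card_univ,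
    Fintype.card_fin, smul_eq_mul]
  congr 1
  · refine Finset.sum_congr rfl fun k _ => ?_
    rw [neg_pow y k]; ring
  · rw [mul_left_comm]
    refine congrArg (fun z : ℝ => (n.factorial : ℝ)⁻¹ * z) ?_
    rw [← intervalIntegral.integral_const_mul]
    refine intervalIntegral.integral_congr fun t _ => ?_
    rw [neg_pow y, mul_neg, ← sub_eq_add_neg]
    ring

/-- The remainder divided by `y ^ (n + 1)` is nondecreasing in `y`, since the signed derivative in
the integrand is antitone. Cross-multiplying keeps `y = 0` admissible. -/
lemma taylorRemainder_mono (hφ : IsPDR φ) {s y b : ℝ} (hy : 0 ≤ y) (hyb : y ≤ b) (hbs : b < s)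
    (n : ℕ) : b ^ (n + 1) * taylorRemainder φ s n y ≤ y ^ (n + 1) * taylorRemainder φ s n b := by
  have hpos : ∀ {z : ℝ}, 0 ≤ z → z ≤ b → ∀ t ∈ Set.Icc (0 : ℝ) 1, 0 < s - t * z := by
    intro z hz hzb t ht
    have : t * z ≤ 1 * z := mul_le_mul_of_nonneg_right ht.2 hz
    linarith
  have hcont : ∀ {z : ℝ}, 0 ≤ z → z ≤ b → IntervalIntegrable
      (fun t => (1 - t) ^ n * ((-1) ^ (n + 1) * iteratedDeriv (n + 1) φ (s - t * z)))
      volume 0 1 := by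
    intro z hz hzb
    refine ContinuousOn.intervalIntegrable ?_
    rw [Set.uIcc_of_le zero_le_one]
    refine ContinuousOn.mul (by fun_prop) (ContinuousOn.mul continuousOn_const ?_)
    intro t ht
    exact ((hφ.hasDerivAt_iteratedDeriv (n + 1) (hpos hz hzb t ht)).continuousAt.comp
      (f := fun t => s - t * z) (by fun_prop)).continuousWithinAt
  have hI : (∫ t in (0 : ℝ)..1,
        (1 - t) ^ n * ((-1) ^ (n + 1) * iteratedDeriv (n + 1) φ (s - t * y)))
      ≤ ∫ t in (0 : ℝ)..1,
        (1 - t) ^ n * ((-1) ^ (n + 1) * iteratedDeriv (n + 1) φ (s - t * b)) := by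
    refine intervalIntegral.integral_mono_on zero_le_one (hcont hy hyb)
      (hcont (hy.trans hyb) le_rfl) fun t ht => ?_
    refine mul_le_mul_of_nonneg_left ?_ (pow_nonneg (by linarith [ht.2]) n)
    exact hφ.antitoneOn_iteratedDeriv (n + 1) (hpos (hy.trans hyb) le_rfl t ht)
      (hpos hy hyb t ht) (by nlinarith [ht.1])
  have h0 : 0 ≤ b ^ (n + 1) * y ^ (n + 1) * (n.factorial : ℝ)⁻¹ := by
    have := hy.trans hyb
    positivity
  have := mul_le_mul_of_nonneg_left hI h0
  unfold taylorRemainder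
  linarith

/-- A completely monotone function on `(0, ∞)` is the sum of its Taylor series at `s` on
`(0, s]`. -/
lemma hasSum_taylor (hφ : IsPDR φ) {s y : ℝ} (hy : 0 ≤ y) (hys : y < s) :
    HasSum (fun k : ℕ => (k.factorial : ℝ)⁻¹ * ((-1) ^ k * iteratedDeriv k φ s) * y ^ k)
      (φ (s - y)) := by
  have hs : 0 < s := hy.trans_lt hys
  have hterm : ∀ {z : ℝ}, 0 ≤ z → ∀ k : ℕ,
      0 ≤ (k.factorial : ℝ)⁻¹ * ((-1) ^ k * iteratedDeriv k φ s) * z ^ k := fun hz k =>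
    mul_nonneg (mul_nonneg (by positivity) (hφ.alternating k s hs)) (pow_nonneg hz k)
  -- At `b` the remainder is at most `φ (s - b) ≤ 1`, all other terms being nonnegative.
  -- Monotonicity of the quotient then gives geometric decay `(y / b) ^ (n + 1)` at `y < b`.
  obtain ⟨b, hyb, hbs⟩ := exists_between hys
  have hb : 0 < b := hy.trans_lt hyb
  have hRb : ∀ n, taylorRemainder φ s n b ≤ 1 := fun n => by
    have h1 := hφ.eq_sum_add_taylorRemainder hb.le hbs n
    have h2 := Finset.sum_nonneg fun k (_ : k ∈ Finset.range (n + 1)) => hterm hb.le k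
    have h3 := hφ.le_one (sub_pos.2 hbs)
    linarith
  have hR0 : ∀ n, 0 ≤ taylorRemainder φ s n y := fun n => by
    refine mul_nonneg (by positivity) (mul_nonneg (by positivity) ?_)
    refine intervalIntegral.integral_nonneg zero_le_one fun t ht => ?_
    refine mul_nonneg (pow_nonneg (by linarith [ht.2]) n) (hφ.alternating _ _ ?_)
    have : t * y ≤ 1 * y := mul_le_mul_of_nonneg_right ht.2 hy
    linarith
  have hR : ∀ n, taylorRemainder φ s n y ≤ (y / b) ^ (n + 1) := fun n => by
    have h1 := hφ.taylorRemainder_mono hy hyb.le hbs n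
    have h2 : y ^ (n + 1) * taylorRemainder φ s n b ≤ y ^ (n + 1) * 1 :=
      mul_le_mul_of_nonneg_left (hRb n) (by positivity)
    rw [div_pow, le_div_iff₀ (by positivity)]
    linarith
  have hlim : Tendsto (fun n => taylorRemainder φ s n y) atTop (𝓝 0) :=
    squeeze_zero hR0 hR ((tendsto_pow_atTop_nhds_zero_of_lt_one (by positivity)
      ((div_lt_one hb).2 hyb)).comp (tendsto_add_atTop_nat 1))
  rw [hasSum_iff_tendsto_nat_of_nonneg (hterm hy), ← tendsto_add_atTop_iff_nat 1]
  have : (fun n => ∑ k ∈ Finset.range (n + 1),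
      (k.factorial : ℝ)⁻¹ * ((-1) ^ k * iteratedDeriv k φ s) * y ^ k)
      = fun n => φ (s - y) - taylorRemainder φ s n y := by
    funext n
    rw [hφ.eq_sum_add_taylorRemainder hy hys n]
    ring
  rw [this]
  simpa using hlim.const_sub (φ (s - y))

end IsPDR

/-! ### Bernstein's theorem -/

/-- `t ↦ t ^ r` as a bounded continuous function on the unit interval. -/
noncomputable def unitIntervalRpow (r : ℝ) (hr : 0 ≤ r) :
    BoundedContinuousFunction unitInterval ℝ :=
  BoundedContinuousFunction.mkOfCompact
    ⟨fun t => (t : ℝ) ^ r, (Real.continuous_rpow_const hr).comp continuous_subtype_val⟩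

@[simp]
lemma unitIntervalRpow_apply (r : ℝ) (hr : 0 ≤ r) (t : unitInterval) :
    unitIntervalRpow r hr t = (t : ℝ) ^ r := rfl

/-- The point `exp (-x)` of the unit interval, for `0 ≤ x`. -/
noncomputable def expNegPoint (x : ℝ≥0) : unitInterval :=
  ⟨Real.exp (-x), (Real.exp_pos _).le, Real.exp_le_one_iff.2 (by simp)⟩

namespace IsPDR

variable {φ : ℝ → ℝ}

/-- There is a probability measure on the unit interval whose moments `∫ t ^ r` approximate `φ r`
as `s → ∞`: it has mass `(-s) ^ k φ⁽ᵏ⁾(s) / k!` at `exp (-k / s)`. -/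
lemma exists_discretization (hφ : IsPDR φ) {s : ℝ≥0} (hs : 0 < s) :
    ∃ μ : ProbabilityMeasure unitInterval, ∀ (r : ℝ), 0 < r →
      ∫ t : unitInterval, (t : ℝ) ^ r ∂(μ : Measure unitInterval)
        = φ (s - s * Real.exp (-(r / s))) := by
  set a : ℕ → ℝ := fun k =>
    (k.factorial : ℝ)⁻¹ * ((-1) ^ k * iteratedDeriv k φ s) * (s : ℝ) ^ k with ha
  have hs' : (0 : ℝ) < s := hs
  have ha0 : ∀ k, 0 ≤ a k := fun k =>
    mul_nonneg (mul_nonneg (by positivity) (hφ.alternating k s hs')) (by positivity)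
  have hau : ∀ u : ℝ, 0 ≤ u → u < 1 → HasSum (fun k => a k * u ^ k) (φ (s - s * u)) := by
    intro u hu hu1
    have := hφ.hasSum_taylor (s := s) (y := s * u) (by positivity) (by nlinarith)
    simpa only [ha, mul_pow, mul_assoc] using this
  -- The series is only known to sum to `φ (s - s * u)` for `u < 1`, so the total mass is bounded by
  -- letting `u ↑ 1` in partial sums.
  have hpart : ∀ n, ∑ k ∈ Finset.range n, a k ≤ 1 := by
    intro n
    have hcont : Tendsto (fun u : ℝ => ∑ k ∈ Finset.range n, a k * u ^ k) (𝓝[<] 1)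
        (𝓝 (∑ k ∈ Finset.range n, a k * 1 ^ k)) :=
      (Continuous.tendsto (by fun_prop) 1).mono_left nhdsWithin_le_nhds
    simp only [one_pow, mul_one] at hcont
    refine le_of_tendsto hcont ?_
    filter_upwards [Ioo_mem_nhdsLT (zero_lt_one (α := ℝ))] with u hu
    refine (sum_le_hasSum _ (fun k _ => mul_nonneg (ha0 k) (pow_nonneg hu.1.le k))
      (hau u hu.1.le hu.2)).trans (hφ.le_one ?_)
    nlinarith [hu.2]
  have hsum : Summable a := summable_of_sum_range_le ha0 hpart
  have hle : ∑' k, a k ≤ 1 := hsum.tsum_le_of_sum_range_le hpart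
  set p : ℕ → unitInterval := fun k => expNegPoint (k / s) with hp
  set ν : Measure unitInterval := Measure.sum fun k => ENNReal.ofReal (a k) • Measure.dirac (p k)
    with hν
  have hνu : ν Set.univ = ENNReal.ofReal (∑' k, a k) := by
    simp [hν, ENNReal.ofReal_tsum_of_nonneg ha0 hsum]
  have hνf : IsFiniteMeasure ν := ⟨by rw [hνu]; exact ENNReal.ofReal_lt_top⟩
  -- Any missing mass is placed at `t = 0`, where `t ^ r` vanishes for `r > 0`; the moments are
  -- unaffected.
  set μ : Measure unitInterval :=
    ν + ENNReal.ofReal (1 - ∑' k, a k) • Measure.dirac 0 with hμ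
  have hμp : IsProbabilityMeasure μ := ⟨by
    simp only [hμ, Measure.add_apply, hνu, Measure.smul_apply, measure_univ, smul_eq_mul, mul_one]
    rw [← ENNReal.ofReal_add (tsum_nonneg ha0) (sub_nonneg.2 hle)]
    simp⟩
  refine ⟨⟨μ, hμp⟩, fun r hr => ?_⟩
  have hint : ∀ (m : Measure unitInterval) [IsFiniteMeasure m],
      Integrable (fun t : unitInterval => (t : ℝ) ^ r) m := fun m _ =>
    (unitIntervalRpow r hr.le).integrable m
  have hd0 : IsFiniteMeasure (ENNReal.ofReal (1 - ∑' k, a k) • Measure.dirac (0 : unitInterval)) :=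
    ⟨by simp⟩
  have h1 : ∫ t : unitInterval, (t : ℝ) ^ r ∂ν = φ (s - s * Real.exp (-(r / s))) := by
    have h2 := hasSum_integral_measure (hint ν)
    refine h2.unique ?_
    have h3 := hau (Real.exp (-(r / s))) (Real.exp_pos _).le
      (Real.exp_lt_one_iff.2 (neg_neg_of_pos (by positivity)))
    refine h3.congr_fun fun k => ?_
    rw [integral_smul_measure, integral_dirac, ENNReal.toReal_ofReal (ha0 k), smul_eq_mul,
      ← Real.exp_nat_mul]
    simp only [hp, expNegPoint]
    rw [← Real.exp_mul]
    push_cast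
    congr 2
    ring
  change ∫ t : unitInterval, (t : ℝ) ^ r ∂μ = _
  rw [hμ, integral_add_measure (hint _) (hint _), h1, integral_smul_measure, integral_dirac]
  simp [Real.zero_rpow hr.ne']

/-- The discretizations with `s = n + 1` have a limit along an ultrafilter, by compactness. Each `t
^ r` is bounded and continuous, so its integrals pass to the limit, and `s - s * exp (-r / s) → r`.
-/
lemma exists_measure_unitInterval (hφ : IsPDR φ) :
    ∃ μ : Measure unitInterval, IsProbabilityMeasure μ ∧ ∀ r : ℝ, 0 < r →
      ∫ t : unitInterval, (t : ℝ) ^ r ∂μ = φ r := by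
  choose μ hμ using fun n : ℕ => hφ.exists_discretization (s := n + 1) (by positivity)
  set U : Ultrafilter (ProbabilityMeasure unitInterval) := (Ultrafilter.of atTop).map μ with hU
  obtain ⟨μ₀, hμ₀⟩ : ∃ μ₀, (U : Filter (ProbabilityMeasure unitInterval)) ≤ 𝓝 μ₀ := by
    obtain ⟨m, -, hm⟩ := isCompact_univ.ultrafilter_le_nhds U (by simp)
    exact ⟨m, hm⟩
  have hlim : Tendsto μ (Ultrafilter.of atTop : Ultrafilter ℕ) (𝓝 μ₀) := hμ₀
  refine ⟨μ₀, inferInstance, fun r hr => ?_⟩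
  have h1 := (ProbabilityMeasure.tendsto_iff_forall_integral_tendsto.1 hlim)
    (unitIntervalRpow r hr.le)
  refine tendsto_nhds_unique h1 ?_
  simp only [unitIntervalRpow_apply, hμ _ r hr]
  refine Tendsto.mono_left ?_ (Ultrafilter.of_le (f := atTop))
  have hφc : ContinuousAt φ r := (hφ.contDiffAt hr 0).continuousAt
  refine hφc.tendsto.comp ?_
  -- With `x = 1 / s`, the argument `s - s * exp (-r / s)` is a difference quotient of this function
  -- at `0`.
  have hd : HasDerivAt (fun x : ℝ => -Real.exp (-(r * x))) r 0 := by
    have := (((hasDerivAt_id (0 : ℝ)).const_mul r).neg.exp).neg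
    refine this.congr_deriv ?_
    simp
  have h2 := (hd.tendsto_slope_zero_right).comp
    ((tendsto_inv_atTop_nhdsGT_zero (𝕜 := ℝ)).comp
      (tendsto_atTop_add_const_right _ (1 : ℝ) tendsto_natCast_atTop_atTop))
  refine h2.congr fun n => ?_
  simp only [Function.comp_apply, zero_add, inv_inv, smul_eq_mul, mul_zero, neg_zero, Real.exp_zero]
  push_cast
  rw [div_eq_mul_inv]
  ring

end IsPDR

/-- Change of variables `ω = -log t`. The point `t = 0` stands for `ω = ∞` and contributes nothing
to the moments; it must be removed because `Real.log 0 = 0` would send its mass to `ω = 0`. -/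
lemma hasLaplaceTransform_of_unitInterval {φ : ℝ → ℝ} {μ : Measure unitInterval}
    [IsFiniteMeasure μ] (h : ∀ r : ℝ, 0 < r → ∫ t : unitInterval, (t : ℝ) ^ r ∂μ = φ r) :
    HasLaplaceTransform
      ((μ.restrict {0}ᶜ).map fun t : unitInterval => (-Real.log t).toNNReal) φ := by
  intro r hr
  have hm : Measurable fun t : unitInterval => (-Real.log t).toNNReal := by fun_prop
  have hc : Continuous fun w : ℝ≥0 => Real.exp (-(r * w)) := by fun_prop
  have he : ∀ t ∈ ({0}ᶜ : Set unitInterval),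
      Real.exp (-(r * (-Real.log t).toNNReal)) = (t : ℝ) ^ r := by
    intro t ht
    have ht0 : (0 : ℝ) < t := unitInterval.pos_iff_ne_zero.2 ht
    rw [Real.coe_toNNReal _ (neg_nonneg.2 (Real.log_nonpos ht0.le t.2.2)),
      Real.rpow_def_of_pos ht0]
    congr 1; ring
  have hs : MeasurableSet ({0}ᶜ : Set unitInterval) := (measurableSet_singleton _).compl
  constructor
  · rw [integrable_map_measure hc.aestronglyMeasurable hm.aemeasurable]
    refine ((unitIntervalRpow r hr.le).integrable (μ.restrict {0}ᶜ)).congr ?_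
    filter_upwards [ae_restrict_mem hs] with t ht
    exact (he t ht).symm
  · rw [integral_map hm.aemeasurable hc.aestronglyMeasurable, setIntegral_congr_fun hs he,
      setIntegral_eq_integral_of_forall_compl_eq_zero, h r hr]
    intro t ht
    rw [Set.notMem_compl_iff, Set.mem_singleton_iff] at ht
    simp [ht, Real.zero_rpow hr.ne']

/-- **Bernstein's theorem**, existence. -/
lemma IsPDR.exists_hasLaplaceTransform {φ : ℝ → ℝ} (hφ : IsPDR φ) :
    ∃ μ : Measure ℝ≥0, HasLaplaceTransform μ φ := by
  obtain ⟨μ, _, hμ⟩ := hφ.exists_measure_unitInterval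
  exact ⟨_, hasLaplaceTransform_of_unitInterval hμ⟩

/-- Monotone convergence along `r = 1 / (n + 1)`. Finiteness of `μ` is a conclusion, so uniqueness
holds among all Borel measures. -/
lemma HasLaplaceTransform.isProbabilityMeasure {φ : ℝ → ℝ} {μ : Measure ℝ≥0}
    (hμ : HasLaplaceTransform μ φ) (hφ : Tendsto φ (𝓝[>] 0) (𝓝 1)) : IsProbabilityMeasure μ := by
  have hr : ∀ n : ℕ, (0 : ℝ) < ((n : ℝ) + 1)⁻¹ := fun n => by positivity
  have h1 : Tendsto (fun n : ℕ => ∫⁻ w : ℝ≥0, ENNReal.ofReal (Real.exp (-(((n : ℝ) + 1)⁻¹ * w))) ∂μ)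
      atTop (𝓝 (∫⁻ _, 1 ∂μ)) := by
    refine lintegral_tendsto_of_tendsto_of_monotone (fun n => by fun_prop) ?_ ?_
    · refine Eventually.of_forall fun w n m hnm => ?_
      dsimp only
      gcongr
    · refine Eventually.of_forall fun w => ?_
      have : Tendsto (fun n : ℕ => ((n : ℝ) + 1)⁻¹) atTop (𝓝 0) :=
        tendsto_inv_atTop_zero.comp
          (tendsto_atTop_add_const_right _ (1 : ℝ) tendsto_natCast_atTop_atTop)
      have := ENNReal.tendsto_ofReal
        ((Real.continuous_exp.tendsto _).comp (this.mul_const (w : ℝ)).neg)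
      simpa [Function.comp_def] using this
  have h2 : Tendsto (fun n : ℕ => ENNReal.ofReal (φ ((n : ℝ) + 1)⁻¹)) atTop (𝓝 1) := by
    have := ENNReal.tendsto_ofReal (hφ.comp ((tendsto_inv_atTop_nhdsGT_zero (𝕜 := ℝ)).comp
      (tendsto_atTop_add_const_right _ (1 : ℝ) tendsto_natCast_atTop_atTop)))
    simpa [Function.comp_def] using this
  refine ⟨?_⟩
  rw [lintegral_one] at h1
  refine tendsto_nhds_unique h1 (h2.congr fun n => ?_)
  rw [← (hμ _ (hr n)).2, ofReal_integral_eq_lintegral_ofReal (hμ _ (hr n)).1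
    (Eventually.of_forall fun _ => (Real.exp_pos _).le)]

/-- A finite measure on `[0, ∞)` is determined by its Laplace transform on `(0, ∞)`. -/
lemma HasLaplaceTransform.eq {φ : ℝ → ℝ} {μ ν : Measure ℝ≥0} (hφ : Tendsto φ (𝓝[>] 0) (𝓝 1))
    (hμ : HasLaplaceTransform μ φ) (hν : HasLaplaceTransform ν φ) : μ = ν := by
  have := hμ.isProbabilityMeasure hφ
  have := hν.isProbabilityMeasure hφ
  let e : BoundedContinuousFunction ℝ≥0 ℝ :=
    BoundedContinuousFunction.ofNormedAddCommGroup (fun w : ℝ≥0 => Real.exp (-(w : ℝ)))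
      (by fun_prop) 1 (fun w => by
        rw [Real.norm_of_nonneg (Real.exp_pos _).le]; exact Real.exp_le_one_iff.2 (by simp))
  have he : ∀ w : ℝ≥0, e w = Real.exp (-(w : ℝ)) := fun w => rfl
  -- Polynomials in `e = exp (-w)` separate points, and their integrals involve the Laplace
  -- transform only at natural numbers.
  let A : StarSubalgebra ℝ (BoundedContinuousFunction ℝ≥0 ℝ) :=
    { Algebra.adjoin ℝ {e} with
      star_mem' := fun {a} ha => by
        have : star a = a := by ext w; simp
        rwa [this] }
  have hA : ∀ g ∈ A, ∃ p : Polynomial ℝ, g = Polynomial.aeval e p := by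
    intro g hg
    have hg' : g ∈ Algebra.adjoin ℝ {e} := hg
    rw [Algebra.adjoin_singleton_eq_range_aeval] at hg'
    obtain ⟨p, hp⟩ := hg'
    exact ⟨p, hp.symm⟩
  refine ext_of_forall_mem_subalgebra_integral_eq_of_polish (𝕜 := ℝ) (A := A) ?_ ?_
  · intro x y hxy
    refine ⟨e, ⟨_, ⟨e, Algebra.self_mem_adjoin_singleton ℝ e, rfl⟩, rfl⟩, ?_⟩
    rw [he, he]
    simpa using hxy
  · intro g hg
    obtain ⟨p, rfl⟩ := hA g hg
    -- The term `k = 0` is the total mass, which the transform on `(0, ∞)` does not give directly;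
    -- hence the separate value `1`.
    have hpow : ∀ (m : Measure ℝ≥0) [IsProbabilityMeasure m], HasLaplaceTransform m φ →
        ∫ w, (Polynomial.aeval e p) w ∂m
          = ∑ k ∈ Finset.range (p.natDegree + 1), p.coeff k * if k = 0 then 1 else φ k := by
      intro m _ hm
      have hterm : ∀ (k : ℕ) (w : ℝ≥0), (e ^ k) w = Real.exp (-((k : ℝ) * w)) := by
        intro k w
        rw [BoundedContinuousFunction.coe_pow, Pi.pow_apply, he, ← Real.exp_nat_mul]
        congr 1; ring
      have hev : ∀ w, (Polynomial.aeval e p) w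
          = ∑ k ∈ Finset.range (p.natDegree + 1), p.coeff k * (e ^ k) w := by
        intro w
        rw [Polynomial.aeval_eq_sum_range, BoundedContinuousFunction.coe_sum, Finset.sum_apply]
        rfl
      simp_rw [hev]
      rw [integral_finsetSum _ fun k _ => ((e ^ k).integrable m).const_mul _]
      refine Finset.sum_congr rfl fun k _ => ?_
      rw [integral_const_mul]
      congr 1
      split_ifs with hk
      · subst hk; simp
      · simp_rw [hterm]
        exact (hm k (by positivity)).2
    rw [hpow μ hμ, hpow ν hν]

lemma IsPDR.existsUnique_hasLaplaceTransform {φ : ℝ → ℝ} (hφ : IsPDR φ) :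
    ∃! μ : Measure ℝ≥0, HasLaplaceTransform μ φ := by
  obtain ⟨μ, hμ⟩ := hφ.exists_hasLaplaceTransform
  exact ⟨μ, hμ, fun ν hν => hν.eq hφ.tendsto_zero hμ⟩

/-! ### The family of exponential tiltings -/

namespace IsPDR

variable {φ : ℝ → ℝ}

lemma hasLaplaceTransform_inverseLaplace (hφ : IsPDR φ) :
    HasLaplaceTransform (inverseLaplace φ) φ := by
  rw [inverseLaplace, dif_pos hφ.exists_hasLaplaceTransform]
  exact hφ.exists_hasLaplaceTransform.choose_spec

lemma piPhi_zero (hφ : IsPDR φ) : piPhi φ 0 = inverseLaplace φ := by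
  simp [piPhi, hφ.map_zero]

lemma isProbabilityMeasure_piPhi_zero (hφ : IsPDR φ) : IsProbabilityMeasure (piPhi φ 0) := by
  rw [hφ.piPhi_zero]
  exact hφ.hasLaplaceTransform_inverseLaplace.isProbabilityMeasure hφ.tendsto_zero

lemma integrable_exp_piPhi_zero (hφ : IsPDR φ) {r : ℝ} (hr : 0 ≤ r) :
    Integrable (fun w : ℝ≥0 => Real.exp (-(r * w))) (piPhi φ 0) := by
  have := hφ.isProbabilityMeasure_piPhi_zero
  rcases hr.eq_or_lt with rfl | hr
  · simp
  · rw [hφ.piPhi_zero]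
    exact (hφ.hasLaplaceTransform_inverseLaplace r hr).1

lemma integral_exp_piPhi_zero (hφ : IsPDR φ) {r : ℝ} (hr : 0 ≤ r) :
    ∫ w : ℝ≥0, Real.exp (-(r * w)) ∂(piPhi φ 0) = φ r := by
  have := hφ.isProbabilityMeasure_piPhi_zero
  rcases hr.eq_or_lt with rfl | hr
  · simp [hφ.map_zero]
  · rw [hφ.piPhi_zero]
    exact (hφ.hasLaplaceTransform_inverseLaplace r hr).2

/-- Complete monotonicity gives only `0 ≤ φ`; strictness comes from integrating a positive function
against a probability measure. It makes division by `φ (c ^ 2)` legitimate. -/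
lemma pos (hφ : IsPDR φ) {r : ℝ} (hr : 0 ≤ r) : 0 < φ r := by
  have := hφ.isProbabilityMeasure_piPhi_zero
  rw [← hφ.integral_exp_piPhi_zero hr]
  exact integral_exp_pos (hφ.integrable_exp_piPhi_zero hr)

lemma le_one' (hφ : IsPDR φ) {r : ℝ} (hr : 0 ≤ r) : φ r ≤ 1 := by
  rcases hr.eq_or_lt with rfl | hr
  · exact hφ.map_zero.le
  · exact hφ.le_one hr

lemma piPhi_eq (hφ : IsPDR φ) (c : ℝ) : piPhi φ c = (piPhi φ 0).withDensity
    (fun w => ENNReal.ofReal (Real.exp (-(c ^ 2 * (w : ℝ))) / φ (c ^ 2))) := by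
  rw [hφ.piPhi_zero, piPhi]

lemma isProbabilityMeasure_piPhi (hφ : IsPDR φ) (c : ℝ) : IsProbabilityMeasure (piPhi φ c) := by
  refine ⟨?_⟩
  rw [hφ.piPhi_eq, withDensity_apply _ MeasurableSet.univ, Measure.restrict_univ,
    ← ofReal_integral_eq_lintegral_ofReal ((hφ.integrable_exp_piPhi_zero (sq_nonneg c)).div_const _)
      (Eventually.of_forall fun w => div_nonneg (Real.exp_pos _).le (hφ.pos (sq_nonneg c)).le),
    integral_div, hφ.integral_exp_piPhi_zero (sq_nonneg c), div_self (hφ.pos (sq_nonneg c)).ne',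
    ENNReal.ofReal_one]

lemma isProbabilityMeasure_auxPrior (hφ : IsPDR φ) (ι : Type*) [Fintype ι] :
    IsProbabilityMeasure (auxPrior ι φ) := by
  have := hφ.isProbabilityMeasure_piPhi_zero
  rw [auxPrior]; infer_instance

/-- `φ` is arbitrary on negative numbers and need not be measurable. On squares it equals a Laplace
integral, which is measurable in its parameter. -/
lemma measurable_comp_sq (hφ : IsPDR φ) : Measurable fun c : ℝ => φ (c ^ 2) := by
  have := hφ.isProbabilityMeasure_piPhi_zero
  have h : (fun c : ℝ => φ (c ^ 2)) =
      fun c : ℝ => ∫ w : ℝ≥0, Real.exp (-(c ^ 2 * w)) ∂(piPhi φ 0) :=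
    funext fun c => (hφ.integral_exp_piPhi_zero (sq_nonneg c)).symm
  rw [h]
  refine (StronglyMeasurable.integral_prod_right' (f := fun p : ℝ × ℝ≥0 =>
    Real.exp (-(p.1 ^ 2 * p.2))) ?_).measurable
  exact Measurable.stronglyMeasurable (by fun_prop)

end IsPDR

/-- A finite product of measures with densities has the product density. -/
lemma pi_withDensity {ι : Type*} [Fintype ι] {α : ι → Type*} [∀ i, MeasurableSpace (α i)]
    (μ : ∀ i, Measure (α i)) [∀ i, SigmaFinite (μ i)] (f : ∀ i, α i → ℝ)
    (hf : ∀ i, Integrable (f i) (μ i)) (hf0 : ∀ i x, 0 ≤ f i x) :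
    Measure.pi (fun i => (μ i).withDensity fun x => ENNReal.ofReal (f i x)) =
      (Measure.pi μ).withDensity fun x => ENNReal.ofReal (∏ i, f i (x i)) := by
  have hfin : ∀ i, IsFiniteMeasure ((μ i).withDensity fun x => ENNReal.ofReal (f i x)) :=
    fun i => isFiniteMeasure_withDensity_ofReal (hf i).2
  refine Measure.pi_eq fun s hs => ?_
  have hms : MeasurableSet (Set.univ.pi s) := MeasurableSet.univ_pi hs
  rw [withDensity_apply _ hms, Measure.restrict_pi_pi]
  have hint' : ∀ i, Integrable (f i) ((μ i).restrict (s i)) := fun i => (hf i).restrict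
  rw [← ofReal_integral_eq_lintegral_ofReal (Integrable.fintype_prod_dep hint')
      (Eventually.of_forall fun x => Finset.prod_nonneg fun i _ => hf0 i _),
    integral_fintype_prod_eq_prod, ENNReal.ofReal_prod_of_nonneg
      fun i _ => integral_nonneg fun x => hf0 i x]
  refine Finset.prod_congr rfl fun i _ => ?_
  rw [withDensity_apply _ (hs i), ofReal_integral_eq_lintegral_ofReal (hint' i)
    (Eventually.of_forall (hf0 i))]

/-! ### The likelihood as a scale mixture -/

namespace SuperGaussianLikelihood

variable {𝒴 κ : Type*} [Fintype κ] (L : SuperGaussianLikelihood 𝒴 κ)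

lemma augLik_eq (y : 𝒴) (f : EuclideanSpace ℝ κ) (w : ℝ≥0) :
    L.augLik y f w = L.C * Real.exp (inner ℝ (L.g y) f) * Real.exp (-(‖L.h y f‖ ^ 2 * w)) := by
  rw [augLik, sub_eq_add_neg, Real.exp_add, mul_assoc]

lemma augLik_pos (y : 𝒴) (f : EuclideanSpace ℝ κ) (w : ℝ≥0) : 0 < L.augLik y f w :=
  mul_pos L.C_pos (Real.exp_pos _)

lemma lik_pos (y : 𝒴) (f : EuclideanSpace ℝ κ) : 0 < L.lik y f :=
  mul_pos (mul_pos L.C_pos (Real.exp_pos _)) (L.isPDR.pos (sq_nonneg _))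

lemma lik_le (y : 𝒴) (f : EuclideanSpace ℝ κ) :
    L.lik y f ≤ L.C * Real.exp (inner ℝ (L.g y) f) :=
  mul_le_of_le_one_right (mul_pos L.C_pos (Real.exp_pos _)).le (L.isPDR.le_one' (sq_nonneg _))

lemma integrable_augLik (y : 𝒴) (f : EuclideanSpace ℝ κ) :
    Integrable (fun w => L.augLik y f w) (piPhi L.φ 0) := by
  simp_rw [augLik_eq]
  exact (L.isPDR.integrable_exp_piPhi_zero (sq_nonneg _)).const_mul _

lemma lik_eq_integral (y : 𝒴) (f : EuclideanSpace ℝ κ) :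
    L.lik y f = ∫ w, L.augLik y f w ∂(piPhi L.φ 0) := by
  simp_rw [augLik_eq]
  rw [integral_const_mul, L.isPDR.integral_exp_piPhi_zero (sq_nonneg _), lik]

/-- The exponential tilting at `‖h(f, y)‖` is the complete conditional of `ω`. -/
lemma augLik_div_lik (y : 𝒴) (f : EuclideanSpace ℝ κ) (w : ℝ≥0) :
    L.augLik y f w / L.lik y f =
      Real.exp (-(‖L.h y f‖ ^ 2 * w)) / L.φ (‖L.h y f‖ ^ 2) := by
  rw [augLik_eq, lik, mul_div_mul_left _ _ (mul_pos L.C_pos (Real.exp_pos _)).ne']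

lemma continuous_h (y : 𝒴) : Continuous (L.h y) := (L.h y).continuous_of_finiteDimensional

lemma measurable_lik (y : 𝒴) : Measurable (L.lik y) := by
  have h1 := L.isPDR.measurable_comp_sq.comp (L.continuous_h y).norm.measurable
  have h2 : Continuous fun f : EuclideanSpace ℝ κ => L.C * Real.exp (inner ℝ (L.g y) f) := by
    fun_prop
  exact h2.measurable.mul h1

lemma continuous_augLik (y : 𝒴) :
    Continuous fun p : EuclideanSpace ℝ κ × ℝ≥0 => L.augLik y p.1 p.2 := by
  have := L.continuous_h y
  unfold augLik
  fun_prop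

end SuperGaussianLikelihood

lemma continuous_block {ι κ : Type*} (i : ι) :
    Continuous fun f : EuclideanSpace ℝ (ι × κ) => block f i := by
  unfold block
  fun_prop

section Model

variable {𝒴 ι κ : Type*} [Fintype ι] [Fintype κ]

variable (L : SuperGaussianLikelihood 𝒴 κ) (y : ι → 𝒴)

lemma fullLik_pos (f : EuclideanSpace ℝ (ι × κ)) : 0 < fullLik L y f :=
  Finset.prod_pos fun _ _ => L.lik_pos _ _

lemma fullAugLik_pos (f : EuclideanSpace ℝ (ι × κ)) (w : ι → ℝ≥0) : 0 < fullAugLik L y f w :=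
  Finset.prod_pos fun _ _ => L.augLik_pos _ _ _

lemma integrable_fullAugLik (f : EuclideanSpace ℝ (ι × κ)) :
    Integrable (fun w => fullAugLik L y f w) (auxPrior ι L.φ) := by
  have := L.isPDR.isProbabilityMeasure_piPhi_zero
  exact Integrable.fintype_prod_dep fun i => L.integrable_augLik (y i) (block f i)

lemma fullLik_eq_integral (f : EuclideanSpace ℝ (ι × κ)) :
    fullLik L y f = ∫ w, fullAugLik L y f w ∂(auxPrior ι L.φ) := by
  have := L.isPDR.isProbabilityMeasure_piPhi_zero
  unfold fullLik fullAugLik auxPrior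
  rw [integral_fintype_prod_eq_prod (fun i w => L.augLik (y i) (block f i) w)]
  exact Finset.prod_congr rfl fun i _ => L.lik_eq_integral _ _

lemma lintegral_fullAugLik (f : EuclideanSpace ℝ (ι × κ)) :
    ∫⁻ w, ENNReal.ofReal (fullAugLik L y f w) ∂(auxPrior ι L.φ) =
      ENNReal.ofReal (fullLik L y f) := by
  rw [fullLik_eq_integral, ofReal_integral_eq_lintegral_ofReal (integrable_fullAugLik L y f)
    (Eventually.of_forall fun w => (fullAugLik_pos L y f w).le)]

lemma measurable_fullLik : Measurable (fullLik L y) := by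
  unfold fullLik
  exact Finset.measurable_prod _ fun i _ =>
    (L.measurable_lik (y i)).comp (continuous_block i).measurable

lemma measurable_fullAugLik :
    Measurable fun p : EuclideanSpace ℝ (ι × κ) × (ι → ℝ≥0) => fullAugLik L y p.1 p.2 := by
  unfold fullAugLik
  refine Finset.measurable_prod _ fun i _ => ((L.continuous_augLik (y i)).measurable.comp
    (g := fun p : EuclideanSpace ℝ κ × ℝ≥0 => L.augLik (y i) p.1 p.2)
    (f := fun p : EuclideanSpace ℝ (ι × κ) × (ι → ℝ≥0) => (block p.1 i, p.2 i)) ?_)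
  exact ((continuous_block i).measurable.comp measurable_fst).prodMk
    ((measurable_pi_apply i).comp measurable_snd)

/-- Bayes' rule for `ω` given `f`: in each factor `C` and the linear exponential cancel, leaving
exactly the tilting density. -/
lemma pi_piPhi_eq (f : EuclideanSpace ℝ (ι × κ)) :
    Measure.pi (fun i => piPhi L.φ ‖L.h (y i) (block f i)‖) =
      (auxPrior ι L.φ).withDensity fun w =>
        ENNReal.ofReal (fullAugLik L y f w / fullLik L y f) := by
  have := L.isPDR.isProbabilityMeasure_piPhi_zero
  simp_rw [L.isPDR.piPhi_eq ‖L.h (y _) (block f _)‖, ← L.augLik_div_lik]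
  rw [pi_withDensity (fun _ => piPhi L.φ 0)
    (fun i w => L.augLik (y i) (block f i) w / L.lik (y i) (block f i))
    (fun i => (L.integrable_augLik _ _).div_const _)
    (fun i w => div_nonneg (L.augLik_pos _ _ _).le (L.lik_pos _ _).le)]
  simp_rw [Finset.prod_div_distrib]
  rfl

end Model

/-! ### Tilting Gaussian measures by quadratic functions -/

lemma map_tilted_comp {α β : Type*} [MeasurableSpace α] [MeasurableSpace β] (μ : Measure α)
    {g : α → β} (hg : Measurable g) {q : β → ℝ} (hq : Measurable q) :
    (μ.tilted fun x => q (g x)).map g = (μ.map g).tilted q := by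
  ext s hs
  rw [Measure.map_apply hg hs, tilted_apply' _ _ (hg hs), tilted_apply' _ _ hs,
    setLIntegral_map hs (by fun_prop) hg,
    integral_map hg.aemeasurable (hq.exp.aestronglyMeasurable)]

lemma tilted_prod_fst {α β : Type*} [MeasurableSpace α] [MeasurableSpace β] (μ : Measure α)
    [SFinite μ] (ν : Measure β) [IsProbabilityMeasure ν] {q : α → ℝ} (hq : Measurable q) :
    (μ.prod ν).tilted (fun p => q p.1) = (μ.tilted q).prod ν := by
  rw [Measure.tilted, Measure.tilted, prod_withDensity_left (by fun_prop)]
  have : ∫ p : α × β, Real.exp (q p.1) ∂(μ.prod ν) = ∫ x, Real.exp (q x) ∂μ := by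
    simpa using integral_prod_mul (μ := μ) (ν := ν) (fun x => Real.exp (q x)) (fun _ => (1 : ℝ))
  rw [this]

/-- Tilting a Gaussian law on the real line by a concave quadratic polynomial. -/
lemma isGaussian_tilted_gaussianReal (m : ℝ) (v : ℝ≥0) {a : ℝ} (ha : 0 ≤ a) (b : ℝ) :
    IsGaussian ((gaussianReal m v).tilted fun x => -a * x ^ 2 + b * x) := by
  rcases eq_or_ne v 0 with rfl | hv
  · rw [gaussianReal_zero_var]
    have : (fun x => -a * x ^ 2 + b * x) =ᵐ[Measure.dirac m] fun _ => -a * m ^ 2 + b * m := by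
      rw [Filter.EventuallyEq, ae_dirac_eq]
      rfl
    rw [tilted_congr this, tilted_const]
    infer_instance
  have hv' : (0 : ℝ) < v := by positivity
  have hd : (0 : ℝ) < 1 + 2 * a * v := by positivity
  -- Completing the square: the new precision is `1 / v' = 1 / v + 2 * a`, the new mean is `m' = v'
  -- * (m / v + b)`, and `K` is the normalizing integral.
  set v' : ℝ≥0 := v / (1 + 2 * a.toNNReal * v) with hv'_def
  have hv'c : (v' : ℝ) = v / (1 + 2 * a * v) := by
    rw [hv'_def]; push_cast; rw [Real.coe_toNNReal a ha]
  have hv'0 : v' ≠ 0 := by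
    rw [← NNReal.coe_ne_zero, hv'c]; positivity
  set m' : ℝ := (m + b * v) / (1 + 2 * a * v) with hm'
  set K : ℝ := (√(2 * Real.pi * v))⁻¹ * √(2 * Real.pi * v')
    * Real.exp (m' ^ 2 / (2 * v') - m ^ 2 / (2 * v)) with hK
  have hK0 : 0 < K := by positivity
  have hpdf : ∀ x, gaussianPDFReal m v x * Real.exp (-a * x ^ 2 + b * x)
      = K * gaussianPDFReal m' v' x := by
    intro x
    have h1 : √(2 * Real.pi * v') * (√(2 * Real.pi * v'))⁻¹ = 1 :=
      mul_inv_cancel₀ (by positivity)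
    rw [gaussianPDFReal, gaussianPDFReal, hK, mul_assoc, ← Real.exp_add]
    calc _ = (√(2 * Real.pi * v))⁻¹ * Real.exp ((m' ^ 2 / (2 * v') - m ^ 2 / (2 * v))
          + -(x - m') ^ 2 / (2 * v')) := by
          congr 2
          rw [hv'c, hm']
          field_simp
          ring
      _ = _ := by
          rw [Real.exp_add]
          linear_combination (-(√(2 * Real.pi * v))⁻¹ *
            (Real.exp (m' ^ 2 / (2 * v') - m ^ 2 / (2 * v))
            * Real.exp (-(x - m') ^ 2 / (2 * v')))) * h1
  have hZ : ∫ x, Real.exp (-a * x ^ 2 + b * x) ∂(gaussianReal m v) = K := by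
    rw [integral_gaussianReal_eq_integral_smul hv]
    simp_rw [smul_eq_mul, hpdf]
    rw [integral_const_mul, integral_gaussianPDFReal_eq_one m' hv'0, mul_one]
  have : (gaussianReal m v).tilted (fun x => -a * x ^ 2 + b * x) = gaussianReal m' v' := by
    rw [Measure.tilted, hZ, gaussianReal_of_var_ne_zero _ hv, gaussianReal_of_var_ne_zero _ hv'0,
      ← withDensity_mul _ (measurable_gaussianPDF m v) (by fun_prop)]
    congr 1
    ext x
    rw [Pi.mul_apply, gaussianPDF, gaussianPDF, ← ENNReal.ofReal_mul (gaussianPDFReal_nonneg _ _ _),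
      mul_div_assoc', hpdf, mul_div_cancel_left₀ _ hK0.ne']
  rw [this]
  infer_instance

section PreservesGaussian

variable {E : Type*} [NormedAddCommGroup E] [NormedSpace ℝ E] [MeasurableSpace E]

/-- Functions `q` such that tilting by `q` maps Gaussian measures to Gaussian measures. -/
def PreservesGaussian (q : E → ℝ) : Prop :=
  ∀ (μ : Measure E) [IsGaussian μ], IsGaussian (μ.tilted q)

/-- `Measure.tilted` is `0` by convention when the weight is not integrable, so Gaussianity of the
tilted measure already forces integrability. -/
lemma PreservesGaussian.integrable_exp {q : E → ℝ} (hq : PreservesGaussian q) (μ : Measure E)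
    [IsGaussian μ] : Integrable (fun x => Real.exp (q x)) μ := by
  by_contra h
  have := hq μ
  exact IsProbabilityMeasure.ne_zero (μ.tilted q) (tilted_of_not_integrable h)

lemma PreservesGaussian.add {q q' : E → ℝ} (hq : PreservesGaussian q)
    (hq' : PreservesGaussian q') : PreservesGaussian fun x => q x + q' x := by
  intro μ _
  have := hq μ
  have h := hq' (μ.tilted q)
  rwa [tilted_tilted (hq.integrable_exp μ)] at h

lemma PreservesGaussian.const (c : ℝ) : PreservesGaussian fun _ : E => c := by
  intro μ _
  rw [tilted_const]
  infer_instance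

lemma PreservesGaussian.sum {ι : Type*} (s : Finset ι) {q : ι → E → ℝ}
    (hq : ∀ i, PreservesGaussian (q i)) : PreservesGaussian fun x => ∑ i ∈ s, q i x := by
  classical
  induction s using Finset.induction_on with
  | empty => simpa using PreservesGaussian.const (E := E) 0
  | insert i s hi ih =>
    simp_rw [Finset.sum_insert hi]
    exact (hq i).add ih

end PreservesGaussian

section Tilt

variable {E : Type*} [NormedAddCommGroup E] [NormedSpace ℝ E] [MeasurableSpace E] [BorelSpace E]
  [SecondCountableTopology E]

/-- Tilting a Gaussian measure by a function of one linear form. -/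
lemma isGaussian_tilted_comp_dual (μ : Measure E) [IsGaussian μ] (L : StrongDual ℝ E)
    {q : ℝ → ℝ} (hq : Measurable q)
    (hG : ∀ (m : ℝ) (v : ℝ≥0), IsGaussian ((gaussianReal m v).tilted q)) :
    IsGaussian (μ.tilted fun x => q (L x)) := by
  have hL2 : MemLp L 2 μ := IsGaussian.memLp_dual μ L 2 (by simp)
  -- In the degenerate case `L` is almost surely constant and tilting changes nothing.
  by_cases hvar : Var[L; μ] = 0
  · have hc := ae_eq_integral_of_variance_eq_zero hL2 hvar
    have : (fun x => q (L x)) =ᵐ[μ] fun _ => q (∫ x, L x ∂μ) := by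
      filter_upwards [hc] with x hx
      rw [hx]
    rw [tilted_congr this, tilted_const]
    infer_instance
  refine isGaussian_of_isGaussian_map fun M => ?_
  have hM2 : MemLp M 2 μ := IsGaussian.memLp_dual μ M 2 (by simp)
  -- Regression of `M` on `L`: the residual `N` is uncorrelated with `L`, hence independent by joint
  -- Gaussianity. Tilting affects only the `L` factor of the product law, and `M = c • L + N`.
  set c : ℝ := cov[L, M; μ] / Var[L; μ] with hc
  set N : StrongDual ℝ E := M - c • L with hN
  have hcov : cov[L, N; μ] = 0 := by
    have hN' : (N : E → ℝ) = M - c • (L : E → ℝ) := by ext x; simp [hN]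
    rw [hN', covariance_sub_right hL2 hM2 (hL2.const_smul c), covariance_smul_right,
      covariance_self hL2.aemeasurable, hc, div_mul_cancel₀ _ hvar, sub_self]
  have hpair : HasGaussianLaw (fun x => (L x, N x)) μ :=
    (IsGaussian.hasGaussianLaw_id (μ := μ)).map_fun (L.prod N)
  have hind : IndepFun L N μ := hpair.indepFun_of_covariance_eq_zero hcov
  have hLm : Measurable L := L.continuous.measurable
  have hNm : Measurable N := N.continuous.measurable
  have hmap : (μ.tilted fun x => q (L x)).map (fun x => (L x, N x))
      = ((μ.map L).tilted q).prod (μ.map N) := by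
    have := (indepFun_iff_map_prod_eq_prod_map_map hLm.aemeasurable hNm.aemeasurable).1 hind
    rw [← tilted_prod_fst _ _ hq, ← this]
    exact map_tilted_comp μ (g := fun x => (L x, N x)) (q := fun p : ℝ × ℝ => q p.1)
      (hLm.prodMk hNm) (hq.comp measurable_fst)
  have hG1 : IsGaussian ((μ.map L).tilted q) := by
    rw [IsGaussian.map_eq_gaussianReal]; exact hG _ _
  let S : ℝ × ℝ →L[ℝ] ℝ := c • ContinuousLinearMap.fst ℝ ℝ ℝ + ContinuousLinearMap.snd ℝ ℝ ℝ
  have hS : (μ.tilted fun x => q (L x)).map M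
      = ((μ.tilted fun x => q (L x)).map (fun x => (L x, N x))).map S := by
    rw [Measure.map_map S.continuous.measurable (hLm.prodMk hNm)]
    congr 1
    ext x
    simp [S, hN]
  rw [hS, hmap]
  infer_instance

lemma PreservesGaussian.quadratic (L : StrongDual ℝ E) {a : ℝ} (ha : 0 ≤ a) (b : ℝ) :
    PreservesGaussian fun x => -a * L x ^ 2 + b * L x := fun μ _ =>
  isGaussian_tilted_comp_dual μ L (q := fun t => -a * t ^ 2 + b * t) (by fun_prop)
    fun m v => isGaussian_tilted_gaussianReal m v ha b

lemma PreservesGaussian.dual (L : StrongDual ℝ E) : PreservesGaussian fun x => L x := by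
  simpa using PreservesGaussian.quadratic L le_rfl 1

lemma PreservesGaussian.neg_mul_sq (L : StrongDual ℝ E) {a : ℝ} (ha : 0 ≤ a) (b : ℝ) :
    PreservesGaussian fun x => -a * (L x + b) ^ 2 := by
  have h := (PreservesGaussian.quadratic L ha (-(2 * a * b))).add (.const (-a * b ^ 2))
  convert h using 2 with x
  ring

/-- The squared norm is the sum of squares of the coordinates, each an affine form, so the one-form
case applies coordinatewise. -/
lemma PreservesGaussian.neg_mul_norm_sq {m : ℕ} (h : E →ᵃ[ℝ] EuclideanSpace ℝ (Fin m))
    (hc : Continuous h) {a : ℝ} (ha : 0 ≤ a) :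
    PreservesGaussian fun x => -a * ‖h x‖ ^ 2 := by
  let A : E →L[ℝ] EuclideanSpace ℝ (Fin m) := ⟨h.linear, h.continuous_linear_iff.2 hc⟩
  have hA : ∀ x, h x = A x + h 0 := fun x => by
    have := congrFun h.decomp x
    exact this
  have key := PreservesGaussian.sum (E := E) Finset.univ fun j : Fin m =>
    PreservesGaussian.neg_mul_sq ((EuclideanSpace.proj j : _ →L[ℝ] ℝ).comp A) ha (h 0 j)
  convert key using 2 with x
  rw [EuclideanSpace.norm_sq_eq, Finset.mul_sum]
  refine Finset.sum_congr rfl fun j _ => ?_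
  rw [hA x]
  simp

end Tilt

/-! ### Disintegration of measures with a density with respect to a product -/

section Disintegration

variable {α β : Type*} [MeasurableSpace α] [MeasurableSpace β]

lemma fst_prod_withDensity (μ : Measure α) (ν : Measure β) [SFinite μ] [SFinite ν]
    {D : α × β → ℝ≥0∞} (hD : Measurable D) :
    ((μ.prod ν).withDensity D).fst = μ.withDensity fun a => ∫⁻ b, D (a, b) ∂ν := by
  ext s hs
  rw [Measure.fst_apply hs, withDensity_apply _ (measurable_fst hs), withDensity_apply _ hs,
    ← Set.prod_univ, setLIntegral_prod _ hD.aemeasurable]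
  simp

/-- The normalized density defines a conditional kernel. -/
lemma exists_isCondKernel_prod_withDensity (μ : Measure α) (ν : Measure β) [SFinite μ] [SFinite ν]
    {D : α × β → ℝ≥0∞} (hD : Measurable D)
    (h0 : ∀ a, ∫⁻ b, D (a, b) ∂ν ≠ 0) (htop : ∀ a, ∫⁻ b, D (a, b) ∂ν ≠ ⊤) :
    ∃ κ : Kernel α β,
      (∀ a, κ a = ν.withDensity fun b => D (a, b) / ∫⁻ b, D (a, b) ∂ν) ∧
      ∀ c : ℝ≥0∞, (c • (μ.prod ν).withDensity D).IsCondKernel κ := by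
  have hZ : Measurable fun a => ∫⁻ b, D (a, b) ∂ν := hD.lintegral_prod_right'
  have hDa : ∀ a, Measurable fun b => D (a, b) := fun a => hD.comp measurable_prodMk_left
  have hdens : Measurable (Function.uncurry fun a b => D (a, b) / ∫⁻ b, D (a, b) ∂ν) :=
    hD.div (hZ.comp measurable_fst)
  set κ : Kernel α β := (Kernel.const α ν).withDensity
    (fun a b => D (a, b) / ∫⁻ b, D (a, b) ∂ν) with hκ
  have hκa : ∀ a, κ a = ν.withDensity fun b => D (a, b) / ∫⁻ b, D (a, b) ∂ν := fun a => by
    rw [hκ, Kernel.withDensity_apply _ hdens, Kernel.const_apply]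
  have hκp : IsMarkovKernel κ := ⟨fun a => ⟨by
    rw [hκa, withDensity_apply _ MeasurableSet.univ, Measure.restrict_univ]
    simp_rw [div_eq_mul_inv]
    rw [lintegral_mul_const _ (hDa a),
      ENNReal.mul_inv_cancel (h0 a) (htop a)]⟩⟩
  refine ⟨κ, hκa, fun c => ⟨?_⟩⟩
  have hbase : ((μ.prod ν).withDensity D).fst ⊗ₘ κ = (μ.prod ν).withDensity D := by
    rw [fst_prod_withDensity μ ν hD]
    ext s hs
    rw [Measure.compProd_apply hs, withDensity_apply _ hs,
      lintegral_withDensity_eq_lintegral_mul _ hZ (Kernel.measurable_kernel_prodMk_left hs),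
      ← lintegral_indicator hs, lintegral_prod _ (hD.indicator hs).aemeasurable]
    refine lintegral_congr fun a => ?_
    have hsa : MeasurableSet (Prod.mk a ⁻¹' s) := measurable_prodMk_left hs
    rw [Pi.mul_apply, hκa, withDensity_apply _ hsa]
    simp_rw [div_eq_mul_inv]
    rw [lintegral_mul_const _ (hDa a), mul_comm, mul_assoc,
      ENNReal.inv_mul_cancel (h0 a) (htop a), mul_one, ← lintegral_indicator hsa]
    rfl
  -- Scaling the joint measure scales its marginal equally, so one kernel serves both the joint
  -- measure and the posterior.
  have hfst : (c • (μ.prod ν).withDensity D).fst = c • ((μ.prod ν).withDensity D).fst := by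
    rw [Measure.fst, Measure.fst, Measure.map_smul]
  rw [hfst, Measure.compProd_smul_left, hbase]

lemma map_swap_prod_withDensity (μ : Measure α) (ν : Measure β) [SFinite μ] [SFinite ν]
    {D : α × β → ℝ≥0∞} (hD : Measurable D) :
    ((μ.prod ν).withDensity D).map Prod.swap = (ν.prod μ).withDensity fun p => D p.swap := by
  ext s hs
  rw [Measure.map_apply measurable_swap hs, withDensity_apply _ (measurable_swap hs),
    withDensity_apply _ hs, ← Measure.prod_swap,
    setLIntegral_map (measurable_swap hs) hD measurable_swap, ← Set.preimage_comp]
  simp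

end Disintegration

/-! ### The augmented model -/

/-- The joint law of finitely many values of a Gaussian process is Gaussian. -/
lemma isGaussian_gpPrior {ι κ T Ω : Type*} [Fintype ι] [Fintype κ] [MeasurableSpace Ω]
    {F : T → Ω → ℝ} {P : Measure Ω} (hF : IsGaussianProcess F P) (x : ι × κ → T) :
    IsGaussian (gpPrior F P x) := by
  have h := (hF.comp_right x).hasGaussianLaw Finset.univ
  let A : (((Finset.univ : Finset (ι × κ)) : Type _) → ℝ) →L[ℝ] EuclideanSpace ℝ (ι × κ) :=
    ((PiLp.continuousLinearEquiv 2 ℝ (fun _ : ι × κ => ℝ)).symm : _ →L[ℝ] _).comp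
      (ContinuousLinearMap.pi fun j => ContinuousLinearMap.proj ⟨j, Finset.mem_univ j⟩)
  exact (h.map_fun A).isGaussian_map

/-- `f ↦ block f i` as a continuous linear map. -/
noncomputable def blockCLM {ι κ : Type*} (i : ι) :
    EuclideanSpace ℝ (ι × κ) →L[ℝ] EuclideanSpace ℝ κ where
  toFun f := block f i
  map_add' _ _ := rfl
  map_smul' _ _ := rfl
  cont := continuous_block i

lemma blockCLM_apply {ι κ : Type*} (i : ι) (f : EuclideanSpace ℝ (ι × κ)) :
    blockCLM i f = block f i := rfl

section Model

variable {𝒴 ι κ : Type*} [Fintype ι] [Fintype κ] (L : SuperGaussianLikelihood 𝒴 κ) (y : ι → 𝒴)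

/-- The logarithm presents the likelihood as an exponential weight, so conditioning becomes tilting.
The quadratic part has the admissible sign because `ωᵢ ≥ 0`. -/
lemma preservesGaussian_log_fullAugLik (w : ι → ℝ≥0) :
    PreservesGaussian fun f => Real.log (fullAugLik L y f w) := by
  have hlog : ∀ f, Real.log (fullAugLik L y f w) = ∑ i, (Real.log L.C
      + ((innerSL ℝ (L.g (y i))).comp (blockCLM i) f
        + -(w i : ℝ) * ‖(L.h (y i)).comp (blockCLM i).toLinearMap.toAffineMap f‖ ^ 2)) := by
    intro f
    rw [fullAugLik, Real.log_prod fun i _ => (L.augLik_pos _ _ _).ne']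
    refine Finset.sum_congr rfl fun i _ => ?_
    rw [SuperGaussianLikelihood.augLik, Real.log_mul L.C_pos.ne' (Real.exp_pos _).ne', Real.log_exp]
    simp [blockCLM_apply]
    ring
  simp_rw [hlog]
  refine PreservesGaussian.sum _ fun i => (PreservesGaussian.const _).add
    ((PreservesGaussian.dual _).add (PreservesGaussian.neg_mul_norm_sq _ ?_ (w i).2))
  exact (L.continuous_h (y i)).comp (blockCLM i).continuous

/-- Since `φ ≤ 1`, the likelihood is dominated by the augmented likelihood at `ω = 0`, the
exponential of an affine form, which is integrable under a Gaussian. -/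
lemma lintegral_fullLik_ne_top (prior : Measure (EuclideanSpace ℝ (ι × κ))) [IsGaussian prior] :
    ∫⁻ f, ENNReal.ofReal (fullLik L y f) ∂prior ≠ ⊤ := by
  have h := (preservesGaussian_log_fullAugLik L y fun _ => 0).integrable_exp prior
  have h1 : Integrable (fun f => fullAugLik L y f fun _ => 0) prior := by
    refine h.congr (Eventually.of_forall fun f => ?_)
    exact Real.exp_log (fullAugLik_pos L y f _)
  refine ((lintegral_mono fun f => ENNReal.ofReal_le_ofReal ?_).trans_lt
    h1.lintegral_lt_top).ne
  refine Finset.prod_le_prod (fun i _ => (L.lik_pos _ _).le) fun i _ => ?_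
  refine (L.lik_le _ _).trans_eq ?_
  simp [SuperGaussianLikelihood.augLik]

lemma augJoint_fst (prior : Measure (EuclideanSpace ℝ (ι × κ))) [SFinite prior] :
    (augJoint L prior y).fst = modelJoint L prior y := by
  have := L.isPDR.isProbabilityMeasure_auxPrior ι
  rw [augJoint, fst_prod_withDensity _ _ (measurable_fullAugLik L y).ennreal_ofReal, modelJoint]
  simp_rw [lintegral_fullAugLik]

lemma isProbabilityMeasure_augPosterior (prior : Measure (EuclideanSpace ℝ (ι × κ)))
    [IsGaussian prior] : IsProbabilityMeasure (augPosterior L prior y) := by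
  have hmass : augJoint L prior y Set.univ = ∫⁻ f, ENNReal.ofReal (fullLik L y f) ∂prior := by
    rw [← Measure.fst_univ, augJoint_fst, modelJoint, withDensity_apply _ MeasurableSet.univ,
      Measure.restrict_univ]
  have h0 : augJoint L prior y Set.univ ≠ 0 := by
    rw [hmass, Ne, lintegral_eq_zero_iff (measurable_fullLik L y).ennreal_ofReal]
    intro h
    obtain ⟨f, hf⟩ := h.exists
    exact (ENNReal.ofReal_pos.2 (fullLik_pos L y f)).ne' hf
  refine ⟨?_⟩
  rw [augPosterior, Measure.smul_apply, smul_eq_mul,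
    ENNReal.inv_mul_cancel h0 (hmass ▸ lintegral_fullLik_ne_top L y prior)]

lemma exists_isCondKernel_augPosterior (prior : Measure (EuclideanSpace ℝ (ι × κ)))
    [SFinite prior] :
    ∃ κω : Kernel (EuclideanSpace ℝ (ι × κ)) (ι → ℝ≥0),
      (∀ f, κω f = Measure.pi (fun i => piPhi L.φ ‖L.h (y i) (block f i)‖)) ∧
      (augPosterior L prior y).IsCondKernel κω := by
  have := L.isPDR.isProbabilityMeasure_auxPrior ι
  obtain ⟨κω, h1, h2⟩ := exists_isCondKernel_prod_withDensity prior (auxPrior ι L.φ)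
    (measurable_fullAugLik L y).ennreal_ofReal
    (fun f => by rw [lintegral_fullAugLik]; exact (ENNReal.ofReal_pos.2 (fullLik_pos L y f)).ne')
    (fun f => by rw [lintegral_fullAugLik]; exact ENNReal.ofReal_ne_top)
  refine ⟨κω, fun f => ?_, h2 _⟩
  rw [h1, pi_piPhi_eq]
  simp_rw [lintegral_fullAugLik, ← ENNReal.ofReal_div_of_pos (fullLik_pos L y f)]

lemma exists_isCondKernel_swap_augPosterior (prior : Measure (EuclideanSpace ℝ (ι × κ)))
    [IsGaussian prior] :
    ∃ κf : Kernel (ι → ℝ≥0) (EuclideanSpace ℝ (ι × κ)),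
      (∀ w, IsGaussian (κf w)) ∧
      ((augPosterior L prior y).map Prod.swap).IsCondKernel κf := by
  have := L.isPDR.isProbabilityMeasure_auxPrior ι
  have hD := (measurable_fullAugLik L y).ennreal_ofReal
  have hG := fun w => preservesGaussian_log_fullAugLik L y w
  have hint : ∀ w, Integrable (fun f => fullAugLik L y f w) prior := fun w =>
    ((hG w).integrable_exp prior).congr
      (Eventually.of_forall fun f => Real.exp_log (fullAugLik_pos L y f w))
  have hZ : ∀ w, ∫⁻ f, ENNReal.ofReal (fullAugLik L y f w) ∂prior
      = ENNReal.ofReal (∫ f, fullAugLik L y f w ∂prior) := fun w =>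
    (ofReal_integral_eq_lintegral_ofReal (hint w)
      (Eventually.of_forall fun f => (fullAugLik_pos L y f w).le)).symm
  -- The normalizer is finite and positive for every `w`, so the kernel is Gaussian everywhere and
  -- not merely almost everywhere.
  have hZ0 : ∀ w, 0 < ∫ f, fullAugLik L y f w ∂prior := fun w => by
    have := integral_exp_pos ((hG w).integrable_exp prior)
    simpa only [Real.exp_log (fullAugLik_pos L y _ w)] using this
  obtain ⟨κf, h1, h2⟩ := exists_isCondKernel_prod_withDensity (auxPrior ι L.φ) prior
    (hD.comp measurable_swap)
    (fun w => by simpa only [Function.comp_apply, Prod.swap_prod_mk, hZ] using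
      (ENNReal.ofReal_pos.2 (hZ0 w)).ne')
    (fun w => by simpa only [Function.comp_apply, Prod.swap_prod_mk, hZ] using
      ENNReal.ofReal_ne_top)
  refine ⟨κf, fun w => ?_, ?_⟩
  · have : κf w = prior.tilted fun f => Real.log (fullAugLik L y f w) := by
      rw [h1, Measure.tilted]
      simp only [Function.comp_apply, Prod.swap_prod_mk, hZ, Real.exp_log (fullAugLik_pos L y _ w),
        ENNReal.ofReal_div_of_pos (hZ0 w)]
    rw [this]
    exact hG w prior
  · rw [augPosterior, Measure.map_smul, augJoint, map_swap_prod_withDensity _ _ hD]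
    exact h2 _

end Model

theorem theorem1 {𝒴 ι κ T Ω : Type*} [Fintype ι] [Fintype κ] [MeasurableSpace Ω]
    -- a super-Gaussian likelihood, a Gaussian process, inputs and observations
    (L : SuperGaussianLikelihood 𝒴 κ)
    (F : T → Ω → ℝ) (P : Measure Ω) (hF : IsGaussianProcess F P)
    (x : ι × κ → T) (y : ι → 𝒴) :
    -- the inverse Laplace transform of `φ` exists and is unique, it is `π_φ(· | 0)`,
    -- and the whole family `π_φ(· | c)` consists of probability measures
    (∃! μ : Measure ℝ≥0, HasLaplaceTransform μ L.φ) ∧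
    HasLaplaceTransform (piPhi L.φ 0) L.φ ∧
    (∀ c : ℝ, IsProbabilityMeasure (piPhi L.φ c)) ∧
    -- every likelihood factor is a scale mixture of the augmented likelihood
    (∀ (y₀ : 𝒴) (f₀ : EuclideanSpace ℝ κ),
      Integrable (fun w => L.augLik y₀ f₀ w) (piPhi L.φ 0) ∧
      L.lik y₀ f₀ = ∫ w, L.augLik y₀ f₀ w ∂(piPhi L.φ 0)) ∧
    -- and so is the likelihood of all the data
    (∀ f : EuclideanSpace ℝ (ι × κ),
      Integrable (fun w => fullAugLik L y f w) (auxPrior ι L.φ) ∧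
      fullLik L y f = ∫ w, fullAugLik L y f w ∂(auxPrior ι L.φ)) ∧
    -- integrating `ω` out of the augmented model gives back the original model
    (augJoint L (gpPrior F P x) y).fst = modelJoint L (gpPrior F P x) y ∧
    -- the posterior of the augmented model is well defined
    IsProbabilityMeasure (augPosterior L (gpPrior F P x) y) ∧
    -- conditional conjugacy in `f`: prior and complete conditional `p(f | ω, y)` are Gaussian
    IsGaussian (gpPrior F P x) ∧
    (∃ κf : Kernel (ι → ℝ≥0) (EuclideanSpace ℝ (ι × κ)),
      (∀ w, IsGaussian (κf w)) ∧
      ((augPosterior L (gpPrior F P x) y).map Prod.swap).IsCondKernel κf) ∧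
    -- conditional conjugacy in `ω`: the complete conditional `p(ω | f, y)` is the product of
    -- the exponential tiltings `π_φ(ωᵢ | ‖h(fᵢ, yᵢ)‖)` of the priors `π_φ(ωᵢ | 0)`
    (∃ κω : Kernel (EuclideanSpace ℝ (ι × κ)) (ι → ℝ≥0),
      (∀ f, κω f = Measure.pi (fun i => piPhi L.φ ‖L.h (y i) (block f i)‖)) ∧
      (augPosterior L (gpPrior F P x) y).IsCondKernel κω) := by
  have hG := isGaussian_gpPrior hF x
  refine ⟨L.isPDR.existsUnique_hasLaplaceTransform, ?_, L.isPDR.isProbabilityMeasure_piPhi,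
    fun y₀ f₀ => ⟨L.integrable_augLik y₀ f₀, L.lik_eq_integral y₀ f₀⟩,
    fun f => ⟨integrable_fullAugLik L y f, fullLik_eq_integral L y f⟩,
    augJoint_fst L y _, isProbabilityMeasure_augPosterior L y _, hG,
    exists_isCondKernel_swap_augPosterior L y _, exists_isCondKernel_augPosterior L y _⟩
  rw [L.isPDR.piPhi_zero]
  exact L.isPDR.hasLaplaceTransform_inverseLaplace
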